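/- Let $\Omega\subset\mathbb R^d$, $d\in\{2,3\}$, be a bounded polyhedral domain (equal to the interior of its closure) with a conforming simplicial triangulation $\mathcal T_h$, let $\mathcal E_h$ be the set of its edges ($d=2$) or faces ($d=3$), and let $l\ge 1$. Put $\boldsymbol U(K)=BDM_l(K)$ for all $K\in\mathcal T_h$, or $\boldsymbol U(K)=BDFM_l(K)$ for all $K\in\mathcal T_h$. For $i=1,\dots,n$ let $$\boldsymbol U_h=\{\boldsymbol u\in H(\mathrm{div};\Omega): \boldsymbol u|_K\in \boldsymbol U(K)\ \forall K\in\mathcal T_h,\ \boldsymbol u\cdot\boldsymbol n=0 \text{ on }\partial\Omega\},$$ $$\boldsymbol V_{i,h}=\{\boldsymbol v\in H(\mathrm{div};\Omega): \boldsymbol v|_K\in RT_{l-1}(K)\ \forall K\in\mathcal T_h,\ \boldsymbol v\cdot\boldsymbol n=0 \text{ on }\partial\Omega\},$$ $$P_{i,h}=\{q\in L^2(\Omega): q|_K\in P_{l-1}(K)\ \forall K\in\mathcal T_h,\ \textstyle\int_\Omega q\,dx=0\},$$ and $\boldsymbol V_h=\prod_i\boldsymbol V_{i,h}$, $\boldsymbol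 P_h=\prod_i P_{i,h}$. Let $\lambda>0$, $R_i^{-1}>0$, $\alpha_{p_i}\ge0$, $\alpha_{ij}\ge0$ $(i,j=1,\dots,n)$ and $\eta\in\mathbb R$ be constants, $\boldsymbol f\in L^2(\Omega)^d$ and $g_i\in L^2(\Omega)$. Let $(\cdot,\cdot)$ be the $L^2(\Omega)$ inner product and $$a_h(\boldsymbol u,\boldsymbol w)=\sum_{K\in\mathcal T_h}\int_K\boldsymbol\epsilon(\boldsymbol u):\boldsymbol\epsilon(\boldsymbol w)\,dx-\sum_{e\in\mathcal E_h}\int_e\{\boldsymbol\epsilon(\boldsymbol u)\}\cdot[\boldsymbol w_t]\,ds-\sum_{e\in\mathcal E_h}\int_e\{\boldsymbol\epsilon(\boldsymbol w)\}\cdot[\boldsymbol u_t]\,ds+\sum_{e\in\mathcal E_h}\int_e\eta h_e^{-1}[\boldsymbol u_t]\cdot[\boldsymbol w_t]\,ds .$$ Here $\boldsymbol\epsilon$ is the symmetric gradient on each element, $h_e$ is the diameter of $e$ and $\boldsymbol u_t=\boldsymbol u-(\boldsymbol u\cdot\boldsymbol n)\boldsymbol n$ on $e$. On an interior $e=\partial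 K_1\cap\partial K_2$, with $\boldsymbol n_k$ the unit normal to $e$ exterior to $K_k$, $\{\boldsymbol\tau\}=\frac12(\boldsymbol\tau|_{K_1}\boldsymbol n_1-\boldsymbol\tau|_{K_2}\boldsymbol n_2)$ and $[\boldsymbol v]=\boldsymbol v|_{K_1}-\boldsymbol v|_{K_2}$; on a boundary $e$, $\{\boldsymbol\tau\}=\boldsymbol\tau\boldsymbol n$ and $[\boldsymbol v]=\boldsymbol v$. Let $(\boldsymbol u_h;\boldsymbol v_h;\boldsymbol p_h)\in\boldsymbol U_h\times\boldsymbol V_h\times\boldsymbol P_h$ satisfy, for all $(\boldsymbol w_h;\boldsymbol z_h;\boldsymbol q_h)\in\boldsymbol U_h\times\boldsymbol V_h\times\boldsymbol P_h$ and all $i=1,\dots,n$, $$a_h(\boldsymbol u_h,\boldsymbol w_h)+\lambda(\mathrm{div}\,\boldsymbol u_h,\mathrm{div}\,\boldsymbol w_h)-\sum_{j=1}^n(p_{j,h},\mathrm{div}\,\boldsymbol w_h)=(\boldsymbol f,\boldsymbol w_h),$$ $$(R_i^{-1}\boldsymbol v_{i,h},\boldsymbol z_{i,h})-(p_{i,h},\mathrm{div}\,\boldsymbol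 z_{i,h})=0,$$ $$-(\mathrm{div}\,\boldsymbol u_h,q_{i,h})-(\mathrm{div}\,\boldsymbol v_{i,h},q_{i,h})-(\alpha_{p_i}+\alpha_{ii})(p_{i,h},q_{i,h})+\sum_{j\ne i}\alpha_{ij}(p_{j,h},q_{i,h})=(g_i,q_{i,h}).$$ Then, with $Q_{i,h}$ the $L^2(\Omega)$-orthogonal projection onto $P_{i,h}$ (so $Q_{i,h}g_i$ is well defined and unique), for $i=1,\dots,n$, every $K\in\mathcal T_h$ and every $x\in K$, $$-\mathrm{div}\,\boldsymbol u_h-\mathrm{div}\,\boldsymbol v_{i,h}-(\alpha_{p_i}+\alpha_{ii})p_{i,h}+\sum_{j\ne i}\alpha_{ij}p_{j,h}=Q_{i,h}g_i ,$$ where all functions are taken as their polynomial restrictions to $K$. Furthermore, if $g_i=0$, then for this $i$ the left-hand side is $0$ at every $x\in K$ for every $K\in\mathcal T_h$. -/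

import Mathlib

open MeasureTheory
open scoped Classical ContDiff

noncomputable section

namespace MPET

/-- Euclidean space `ℝ^d`. -/
abbrev Pt (d : ℕ) := EuclideanSpace ℝ (Fin d)

/-- Real polynomials in `d` variables. -/
abbrev Poly (d : ℕ) := MvPolynomial (Fin d) ℝ

/-- Vector fields on `ℝ^d` with polynomial components. -/
abbrev VecPoly (d : ℕ) := Fin d → Poly d

/-! ### Weak divergence, weak gradient, `H(div)` and the normal trace -/

/-- `φ ∈ C_c^∞(Ω)`. -/
def IsTest {d : ℕ} (Ω : Set (Pt d)) (φ : Pt d → ℝ) : Prop :=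
  ContDiff ℝ ∞ φ ∧ HasCompactSupport φ ∧ tsupport φ ⊆ Ω

/-- `g` is the weak divergence of `v` in `Ω`. -/
def IsWeakDiv {d : ℕ} (Ω : Set (Pt d)) (v : Pt d → Pt d) (g : Pt d → ℝ) : Prop :=
  ∀ φ, IsTest Ω φ → ∫ x in Ω, inner ℝ (v x) (gradient φ x) = -∫ x in Ω, g x * φ x

/-- `G` is the weak gradient of the scalar function `φ` in `Ω`. -/
def IsWeakGrad {d : ℕ} (Ω : Set (Pt d)) (φ : Pt d → ℝ) (G : Pt d → Pt d) : Prop :=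
  ∀ ψ, IsTest Ω ψ → ∫ x in Ω, φ x • gradient ψ x = -∫ x in Ω, ψ x • G x

/-- `L²(Ω)` for functions with values in a normed space. -/
def InL2 {d : ℕ} {F : Type*} [NormedAddCommGroup F] (Ω : Set (Pt d)) (f : Pt d → F) : Prop :=
  MemLp f 2 (volume.restrict Ω)

/-- `v ∈ H(div; Ω)`: both `v` and its weak divergence are square integrable. -/
def InHDiv {d : ℕ} (Ω : Set (Pt d)) (v : Pt d → Pt d) : Prop :=
  InL2 Ω v ∧ ∃ g, InL2 Ω g ∧ IsWeakDiv Ω v g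

/-- `v · n = 0` on `∂Ω` for `v ∈ H(div; Ω)`. The normal trace of `v` is the functional
`φ ↦ ∫_Ω v · ∇φ + ∫_Ω (div v) φ` on `H¹(Ω)`; it is required to vanish. -/
def ZeroNormalTrace {d : ℕ} (Ω : Set (Pt d)) (v : Pt d → Pt d) : Prop :=
  ∀ g, InL2 Ω g → IsWeakDiv Ω v g →
    ∀ φ G, InL2 Ω φ → InL2 Ω G → IsWeakGrad Ω φ G →
      (∫ x in Ω, inner ℝ (v x) (G x)) + (∫ x in Ω, g x * φ x) = 0

/-! ### Triangulations -/

/-- A (conforming, simplicial) triangulation of the open set `Ω ⊆ ℝ^d`. -/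
structure Triangulation (d : ℕ) (Ω : Set (Pt d)) where
  /-- all simplices of the triangulation, of all dimensions, given by their vertex sets -/
  complex : Geometry.SimplicialComplex ℝ (Pt d)
  finite : complex.faces.Finite
  /-- every simplex is a face of a `d`-dimensional one -/
  pure : ∀ s ∈ complex.faces, ∃ t ∈ complex.faces, s ⊆ t ∧ t.card = d + 1
  /-- the simplices fill the closure of `Ω` -/
  space_eq : complex.space = closure Ω
  /-- `Ω` is the open set inside its boundary (no cracks, no punctures) -/
  interior_eq : interior (closure Ω) = Ω

namespace Triangulation

variable {d : ℕ} {Ω : Set (Pt d)} (T : Triangulation d Ω)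

/-- The elements `K ∈ 𝒯_h`: the `d`-dimensional simplices. -/
def Element : Type := {s : Finset (Pt d) // s ∈ T.complex.faces ∧ s.card = d + 1}

/-- The edges (`d = 2`) or faces (`d = 3`) `e ∈ ℰ_h`: the `(d-1)`-dimensional simplices. -/
def Face : Type := {s : Finset (Pt d) // s ∈ T.complex.faces ∧ s.card = d}

instance : Fintype T.Element :=
  (T.finite.subset (show {s | s ∈ T.complex.faces ∧ s.card = d + 1} ⊆ T.complex.faces
    from fun _ h => h.1)).fintype

instance : Fintype T.Face :=
  (T.finite.subset (show {s | s ∈ T.complex.faces ∧ s.card = d} ⊆ T.complex.faces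
    from fun _ h => h.1)).fintype

variable {T}

/-- The element as a closed subset of `ℝ^d`. -/
def Element.carrier (K : T.Element) : Set (Pt d) := convexHull ℝ (K.1 : Set (Pt d))

/-- The edge or face as a closed subset of `ℝ^d`. -/
def Face.carrier (e : T.Face) : Set (Pt d) := convexHull ℝ (e.1 : Set (Pt d))

/-- `e` is an edge or face of the element `K`. -/
def IsFaceOf (e : T.Face) (K : T.Element) : Prop := e.1 ⊆ K.1

/-- The unit normal to the face `e` of the element `K` pointing to the exterior of `K`: the vector
from the barycentre of `K` to the barycentre of `e`, projected to the orthogonal complement of the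
directions of `e` and normalized. -/
def outerNormal (K : T.Element) (e : T.Face) : Pt d :=
  let m : Pt d := (vectorSpan ℝ (e.1 : Set (Pt d)))ᗮ.starProjection
    (e.1.centroid ℝ id - K.1.centroid ℝ id)
  ‖m‖⁻¹ • m

/-! ### The two sides of a face -/

theorem Face.exists_side (e : T.Face) : ∃ K : T.Element, IsFaceOf e K := by
  obtain ⟨t, ht, hst, hc⟩ := T.pure e.1 e.2.1
  exact ⟨⟨t, ht, hc⟩, hst⟩

/-- The element `K₁` at the face `e`. The order in which the two elements at an interior face are
called `K₁` and `K₂` is immaterial. -/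
def Face.side₁ (e : T.Face) : T.Element := e.exists_side.choose

/-- `e` is an interior face: it belongs to a second element; otherwise it is a boundary face. -/
def Face.IsInterior (e : T.Face) : Prop := ∃ K : T.Element, K ≠ e.side₁ ∧ IsFaceOf e K

/-- The element `K₂` at an interior face `e`. -/
def Face.side₂ (e : T.Face) (h : e.IsInterior) : T.Element := h.choose

end Triangulation

/-! ### Polynomials and piecewise polynomial functions -/

section Polynomials

variable {d : ℕ}

/-- Value of a polynomial at a point. -/
def ev (p : Poly d) (x : Pt d) : ℝ := MvPolynomial.eval (fun i => x i) p

/-- Value of a polynomial vector field at a point. -/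
def evVec (v : VecPoly d) (x : Pt d) : Pt d := WithLp.toLp 2 fun i => ev (v i) x

/-- `P_k`: polynomials of total degree at most `k`. -/
def Pk (d k : ℕ) : Submodule ℝ (Poly d) := MvPolynomial.restrictTotalDegree (Fin d) ℝ k

/-- Divergence of a polynomial vector field. -/
def divPoly (v : VecPoly d) : Poly d := ∑ i, MvPolynomial.pderiv i (v i)

/-- The strain `ε(v) = (∇v + (∇v)ᵀ) / 2` of a polynomial vector field, at the point `x`. -/
def strain (v : VecPoly d) (x : Pt d) : Matrix (Fin d) (Fin d) ℝ :=
  fun i j => (1 / 2 : ℝ) *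
    (ev (MvPolynomial.pderiv j (v i)) x + ev (MvPolynomial.pderiv i (v j)) x)

end Polynomials

section Spaces

variable {d : ℕ} {Ω : Set (Pt d)} (T : Triangulation d Ω)

/-- A piecewise polynomial scalar function `q`, given by its restrictions `q|_K`. -/
abbrev Scal := T.Element → Poly d

/-- A piecewise polynomial vector field `v`, given by its restrictions `v|_K`. -/
abbrev Vect := T.Element → VecPoly d

variable {T}

/-- The piecewise polynomial `q` as a function. On points common to several elements (a null set)
one of the values is taken. -/
def Scal.toFun (q : Scal T) (x : Pt d) : ℝ :=
  if h : ∃ K : T.Element, x ∈ K.carrier then ev (q h.choose) x else 0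

/-- The piecewise polynomial vector field `v` as a function. -/
def Vect.toFun (v : Vect T) (x : Pt d) : Pt d :=
  if h : ∃ K : T.Element, x ∈ K.carrier then evVec (v h.choose) x else 0

/-- Divergence of a piecewise polynomial vector field, on each element. -/
def Vect.div (v : Vect T) : Scal T := fun K => divPoly (v K)

/-- The two choices for the local displacement space. -/
inductive Family
  | BDM
  | BDFM

/-- `BDM_l(K) = P_l(K)^d`, and `BDFM_l(K)`, the fields in `P_l(K)^d` whose normal component on each
edge or face of `K` is a polynomial of degree at most `l - 1`. -/
def localU : Family → ℕ → T.Element → Set (VecPoly d)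
  | .BDM, l, _ => {v | ∀ i, v i ∈ Pk d l}
  | .BDFM, l, K => {v | (∀ i, v i ∈ Pk d l) ∧
      ∀ e : T.Face, Triangulation.IsFaceOf e K → ∃ r ∈ Pk d (l - 1), ∀ x ∈ e.carrier,
        inner ℝ (evVec v x) (Triangulation.outerNormal K e) = ev r x}

/-- `RT_k(K) = P_k(K)^d + x P_k(K)`. -/
def localRT (d k : ℕ) : Set (VecPoly d) :=
  {v | ∃ a : VecPoly d, ∃ b : Poly d, (∀ i, a i ∈ Pk d k) ∧ b ∈ Pk d k ∧
    ∀ i, v i = a i + MvPolynomial.X i * b}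

variable (T)

/-- The displacement space `U_h`. -/
def Uh (fam : Family) (l : ℕ) : Set (Vect T) :=
  {u | (∀ K, u K ∈ localU fam l K) ∧ InHDiv Ω u.toFun ∧ ZeroNormalTrace Ω u.toFun}

/-- The flux space `V_{i,h}`, the same for every `i`. -/
def Vh (l : ℕ) : Set (Vect T) :=
  {v | (∀ K, v K ∈ localRT d (l - 1)) ∧ InHDiv Ω v.toFun ∧ ZeroNormalTrace Ω v.toFun}

/-- The pressure space `P_{i,h}`, the same for every `i`. -/
def Ph (l : ℕ) : Set (Scal T) :=
  {q | (∀ K, q K ∈ Pk d (l - 1)) ∧ InL2 Ω q.toFun ∧ ∫ x in Ω, q.toFun x = 0}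

variable {T}

/-- `q` is the `L²(Ω)`-orthogonal projection of `g` on `P_{i,h}`. -/
def IsL2Projection (l : ℕ) (g : Pt d → ℝ) (q : Scal T) : Prop :=
  q ∈ Ph T l ∧ ∀ r ∈ Ph T l, ∫ x in Ω, (g x - q.toFun x) * r.toFun x = 0

/-! ### The bilinear form of the elasticity part -/

/-- The average `{ε(u)}` on the face `e`. -/
def avgStrain (u : Vect T) (e : T.Face) (x : Pt d) : Pt d :=
  let τn (K : T.Element) : Pt d :=
    WithLp.toLp 2 ((strain (u K) x).mulVec (fun i => Triangulation.outerNormal K e i))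
  if h : e.IsInterior then (1 / 2 : ℝ) • (τn e.side₁ - τn (e.side₂ h)) else τn e.side₁

/-- The tangential component `w - (w · n) n` on the face `e`. -/
def tangential (e : T.Face) (w : Pt d) : Pt d :=
  w - inner ℝ w (Triangulation.outerNormal e.side₁ e) • Triangulation.outerNormal e.side₁ e

/-- The jump `[u_t]` of the tangential component on the face `e`. -/
def jumpTan (u : Vect T) (e : T.Face) (x : Pt d) : Pt d :=
  if h : e.IsInterior then
    tangential e (evVec (u e.side₁) x) - tangential e (evVec (u (e.side₂ h)) x)
  else tangential e (evVec (u e.side₁) x)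

/-- `h_e`: the diameter of the face `e`. -/
def faceSize (e : T.Face) : ℝ := Metric.diam e.carrier

/-- `∫_e φ ds`, with respect to the `(d-1)`-dimensional surface measure. -/
def faceIntegral (e : T.Face) (φ : Pt d → ℝ) : ℝ := ∫ x in e.carrier, φ x ∂μHE[d - 1]

/-- The bilinear form `a_h`, with stabilization parameter `η`. -/
def aForm (η : ℝ) (u w : Vect T) : ℝ :=
  ∑ K : T.Element, (∫ x in K.carrier, ∑ i, ∑ j, strain (u K) x i j * strain (w K) x i j)
    - ∑ e : T.Face, faceIntegral e (fun x => inner ℝ (avgStrain u e x) (jumpTan w e x))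
    - ∑ e : T.Face, faceIntegral e (fun x => inner ℝ (avgStrain w e x) (jumpTan u e x))
    + ∑ e : T.Face,
        faceIntegral e (fun x => η * (faceSize e)⁻¹ * inner ℝ (jumpTan u e x) (jumpTan w e x))

end Spaces

/-! ### The discrete problem -/

/-- The (rescaled) parameters of the model with `n` networks. Only the off-diagonal entries of `α`
couple different networks; `α i i` enters through the sum `αp i + α i i`. -/
structure Params (n : ℕ) where
  lam : ℝ
  Rinv : Fin n → ℝ
  αp : Fin n → ℝ
  α : Fin n → Fin n → ℝ
  lam_pos : 0 < lam
  Rinv_pos : ∀ i, 0 < Rinv i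
  αp_nonneg : ∀ i, 0 ≤ αp i
  α_nonneg : ∀ i j, 0 ≤ α i j

variable {d : ℕ} {Ω : Set (Pt d)} {T : Triangulation d Ω} {n : ℕ}

/-- `(u_h; v_h; p_h) ∈ U_h × V_h × P_h` solves the discrete problem with data `f` and `g`. -/
structure IsDiscreteSolution (fam : Family) (l : ℕ) (η : ℝ) (c : Params n)
    (f : Pt d → Pt d) (g : Fin n → Pt d → ℝ)
    (u : Vect T) (v : Fin n → Vect T) (p : Fin n → Scal T) : Prop where
  u_mem : u ∈ Uh T fam l
  v_mem : ∀ i, v i ∈ Vh T l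
  p_mem : ∀ i, p i ∈ Ph T l
  momentum : ∀ w ∈ Uh T fam l,
    aForm η u w + c.lam * (∫ x in Ω, u.div.toFun x * w.div.toFun x)
      - ∑ i, (∫ x in Ω, (p i).toFun x * w.div.toFun x) = ∫ x in Ω, inner ℝ (f x) (w.toFun x)
  darcy : ∀ i, ∀ z ∈ Vh T l,
    (∫ x in Ω, inner ℝ (c.Rinv i • (v i).toFun x) (z.toFun x))
      - (∫ x in Ω, (p i).toFun x * z.div.toFun x) = 0
  mass : ∀ i, ∀ q ∈ Ph T l,
    -(∫ x in Ω, u.div.toFun x * q.toFun x) - (∫ x in Ω, (v i).div.toFun x * q.toFun x)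
      + (-c.αp i - c.α i i) * (∫ x in Ω, (p i).toFun x * q.toFun x)
      + ∑ j ∈ Finset.univ.erase i, c.α i j * (∫ x in Ω, (p j).toFun x * q.toFun x)
      = ∫ x in Ω, g i x * q.toFun x

/-- The left-hand side of the `i`-th mass-balance equation, at the point `x` of the element `K`. -/
def massBalance (c : Params n) (u : Vect T) (v : Fin n → Vect T) (p : Fin n → Scal T)
    (i : Fin n) (K : T.Element) (x : Pt d) : ℝ :=
  -ev (divPoly (u K)) x - ev (divPoly (v i K)) x - (c.αp i + c.α i i) * ev (p i K) x
    + ∑ j ∈ Finset.univ.erase i, c.α i j * ev (p j K) x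

end MPET

end

/-! The divergences of `u_h` and `v_{i,h}` again lie in `P_h`: they are piecewise polynomials of
degree at most `l - 1`, and testing the vanishing normal trace with the constant function `1` shows
that they have mean value zero. Hence the left-hand side of the mass balance is an element of `P_h`
with the same `L²` products with `P_h` as `g_i`, that is, it is the projection of `g_i`. The fields
are only known to have some weak divergence on `Ω`; it is the elementwise divergence, because weak
divergences restrict to open subsets and are unique there. -/

namespace MPET

open MvPolynomial

variable {d : ℕ}

/-! ### Degrees and derivatives of polynomials -/

section Degree

variable {σ R : Type*} [CommSemiring R]

theorem totalDegree_pderiv_le (i : σ) (p : MvPolynomial σ R) :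
    (pderiv i p).totalDegree ≤ p.totalDegree - 1 := by
  refine Finset.sup_le fun m hm => ?_
  have hm' : m + Finsupp.single i 1 ∈ p.support := by
    rw [mem_support_iff, coeff_pderiv] at hm
    exact mem_support_iff.2 (left_ne_zero_of_mul hm)
  have hdeg := le_totalDegree hm'
  rw [Finsupp.sum_add_index' (fun _ => rfl) (fun _ _ _ => rfl),
    Finsupp.sum_single_index rfl] at hdeg
  omega

theorem totalDegree_X_mul_pderiv_le (i : σ) (p : MvPolynomial σ R) :
    (X i * pderiv i p).totalDegree ≤ p.totalDegree := by
  rcases Nat.eq_zero_or_pos p.totalDegree with h | h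
  · rw [totalDegree_eq_zero_iff_eq_C.1 h, pderiv_C, mul_zero, totalDegree_zero]
    exact Nat.zero_le _
  · calc (X i * pderiv i p).totalDegree
        ≤ (X i : MvPolynomial σ R).totalDegree + (pderiv i p).totalDegree := totalDegree_mul _ _
      _ ≤ 1 + (p.totalDegree - 1) :=
        add_le_add (totalDegree_monomial_le _ _ |>.trans_eq (by simp)) (totalDegree_pderiv_le i p)
      _ = p.totalDegree := Nat.add_sub_cancel' h

end Degree

theorem divPoly_mem_Pk {k : ℕ} {v : VecPoly d} (hv : ∀ i, v i ∈ Pk d (k + 1)) :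
    divPoly v ∈ Pk d k := by
  refine sum_mem fun i _ => (mem_restrictTotalDegree _ _ _).2 ?_
  have hdeg := (mem_restrictTotalDegree _ _ _).1 (hv i)
  exact (totalDegree_pderiv_le i _).trans (Nat.sub_le_of_le_add hdeg)

theorem divPoly_mem_Pk_of_mem_localRT {k : ℕ} {v : VecPoly d} (hv : v ∈ localRT d k) :
    divPoly v ∈ Pk d k := by
  obtain ⟨a, b, ha, hb, hab⟩ := hv
  refine sum_mem fun i _ => ?_
  rw [hab i, map_add, pderiv_mul, pderiv_X_self, one_mul]
  refine add_mem ?_ (add_mem hb ?_) <;> refine (mem_restrictTotalDegree _ _ _).2 ?_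
  · exact (totalDegree_pderiv_le i _).trans <|
      (Nat.sub_le _ 1).trans ((mem_restrictTotalDegree _ _ _).1 (ha i))
  · exact (totalDegree_X_mul_pderiv_le i b).trans ((mem_restrictTotalDegree _ _ _).1 hb)

theorem contDiff_ev (p : Poly d) {n : WithTop ℕ∞} : ContDiff ℝ n (ev p) :=
  (AnalyticOnNhd.eval_mvPolynomial p).contDiff.comp (EuclideanSpace.equiv (Fin d) ℝ).contDiff

theorem continuous_ev (p : Poly d) : Continuous (ev p) :=
  (contDiff_ev p (n := 0)).continuous

theorem fderiv_ev_single (p : Poly d) (x : Pt d) (i : Fin d) :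
    fderiv ℝ (ev p) x (EuclideanSpace.single i 1) = ev (pderiv i p) x := by
  have hdiff (q : Poly d) : DifferentiableAt ℝ (ev q) x :=
    (contDiff_ev q (n := 1)).differentiable one_ne_zero x
  induction p using MvPolynomial.induction_on with
  | C a =>
    have hC : (ev (C a) : Pt d → ℝ) = fun _ => a := by ext y; simp [ev]
    simp [hC, ev]
  | add p q hp hq =>
    have hadd : (ev (p + q) : Pt d → ℝ) = ev p + ev q := by ext y; simp [ev]
    rw [hadd, fderiv_add (hdiff p) (hdiff q), add_apply, hp, hq, map_add]
    simp [ev]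
  | mul_X p j hp =>
    have hmul : (ev (p * X j) : Pt d → ℝ) = fun y => ev p y * EuclideanSpace.proj (𝕜 := ℝ) j y := by
      ext y; simp [ev]
    rw [hmul, fderiv_fun_mul (hdiff p) (ContinuousLinearMap.differentiableAt _),
      ContinuousLinearMap.fderiv, pderiv_mul, add_apply, smul_apply, smul_apply, hp]
    rcases eq_or_ne j i with rfl | hji
    · simp [ev, mul_comm, add_comm]
    · simp [ev, hji, mul_comm]

theorem eq_of_eqOn_ev {U : Set (Pt d)} (hU : IsOpen U) (hne : U.Nonempty) {p q : Poly d}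
    (h : Set.EqOn (ev p) (ev q) U) : p = q := by
  obtain ⟨x, hx⟩ := hne
  have hV : IsOpen ((fun y : Fin d → ℝ => (WithLp.toLp 2 y : Pt d)) ⁻¹' U) :=
    hU.preimage (PiLp.continuous_toLp 2 _)
  obtain ⟨ε, hε, hball⟩ := Metric.isOpen_iff.1 hV x.ofLp hx
  refine funext_set (fun i => Metric.ball (x i) ε) (fun i => ?_) fun y hy => ?_
  · rw [Real.ball_eq_Ioo]
    exact Set.Ioo_infinite (by linarith)
  · rw [← ball_pi _ hε] at hy
    exact h (hball hy)

/-! ### Test functions and weak divergences -/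

section WeakDiv

variable {Ω U : Set (Pt d)} {φ : Pt d → ℝ} {v w : Pt d → Pt d} {f g : Pt d → ℝ}

theorem IsTest.mono (hφ : IsTest U φ) (hU : U ⊆ Ω) : IsTest Ω φ :=
  ⟨hφ.1, hφ.2.1, hφ.2.2.trans hU⟩

theorem IsTest.eq_zero_of_notMem (hφ : IsTest Ω φ) {x : Pt d} (hx : x ∉ Ω) : φ x = 0 :=
  image_eq_zero_of_notMem_tsupport fun h => hx (hφ.2.2 h)

theorem IsTest.gradient_eq_zero_of_notMem (hφ : IsTest Ω φ) {x : Pt d} (hx : x ∉ Ω) :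
    gradient φ x = 0 := by
  have hfderiv : fderiv ℝ φ x = 0 :=
    image_eq_zero_of_notMem_tsupport fun h => hx (hφ.2.2 (tsupport_fderiv_subset ℝ h))
  rw [gradient, hfderiv, map_zero]

theorem IsTest.integrable_gradient (hφ : IsTest Ω φ) : Integrable (gradient φ) :=
  let toDual := (InnerProductSpace.toDual ℝ (Pt d)).symm
  (toDual.continuous.comp (hφ.1.continuous_fderiv (by simp))).integrable_of_hasCompactSupport
    ((hφ.2.1.fderiv (𝕜 := ℝ)).comp_left (map_zero toDual))

theorem IsTest.integrable_mul (hφ : IsTest Ω φ) (hf : LocallyIntegrableOn f Ω) :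
    Integrable fun x => f x * φ x := by
  have hsupp : Function.support (fun x => f x * φ x) ⊆ tsupport φ :=
    (Function.support_mul_subset_right _ _).trans (subset_tsupport φ)
  rw [← integrableOn_iff_integrable_of_support_subset hsupp]
  exact (hf.integrableOn_compact_subset hφ.2.2 hφ.2.1).mul_continuousOn
    hφ.1.continuous.continuousOn hφ.2.1

theorem isWeakDiv_iff_integral : IsWeakDiv Ω v g ↔
    ∀ φ, IsTest Ω φ → ∫ x, inner ℝ (v x) (gradient φ x) = -∫ x, g x * φ x := by
  refine forall₂_congr fun φ hφ => ?_
  rw [setIntegral_eq_integral_of_forall_compl_eq_zero fun x hx => by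
      rw [hφ.gradient_eq_zero_of_notMem hx, inner_zero_right],
    setIntegral_eq_integral_of_forall_compl_eq_zero fun x hx => by
      rw [hφ.eq_zero_of_notMem hx, mul_zero]]

theorem IsWeakDiv.mono (h : IsWeakDiv Ω v g) (hU : U ⊆ Ω) : IsWeakDiv U v g :=
  isWeakDiv_iff_integral.2 fun φ hφ => isWeakDiv_iff_integral.1 h φ (hφ.mono hU)

theorem IsWeakDiv.congr_ae (h : IsWeakDiv Ω v g) (hvw : v =ᵐ[volume.restrict Ω] w) :
    IsWeakDiv Ω w g := fun φ hφ => by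
  rw [← h φ hφ]
  exact integral_congr_ae (hvw.mono fun x hx => by simp only [hx])

theorem IsWeakDiv.ae_eq (hΩ : IsOpen Ω) (hf : LocallyIntegrableOn f Ω)
    (hg : LocallyIntegrableOn g Ω) (hvf : IsWeakDiv Ω v f) (hvg : IsWeakDiv Ω v g) :
    f =ᵐ[volume.restrict Ω] g := by
  have hsub : ∀ᵐ x, x ∈ Ω → (f - g) x = 0 := by
    refine hΩ.ae_eq_zero_of_integral_contDiff_smul_eq_zero (hf.sub hg) fun φ hφ hc hs => ?_
    have hφ : IsTest Ω φ := ⟨hφ, hc, hs⟩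
    have heq : ∫ x, f x * φ x = ∫ x, g x * φ x := neg_injective <| by
      rw [← isWeakDiv_iff_integral.1 hvf φ hφ, isWeakDiv_iff_integral.1 hvg φ hφ]
    simp only [smul_eq_mul, Pi.sub_apply, mul_comm (φ _), sub_mul]
    rw [integral_sub (hφ.integrable_mul hf) (hφ.integrable_mul hg), heq, sub_self]
  filter_upwards [(ae_restrict_iff' hΩ.measurableSet).2 hsub] with x hx using sub_eq_zero.1 hx

theorem isWeakDiv_of_contDiff (Ω : Set (Pt d)) (hv : ContDiff ℝ 1 v) :
    IsWeakDiv Ω v fun x => ∑ i, fderiv ℝ (fun y => v y i) x (EuclideanSpace.single i 1) := by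
  refine isWeakDiv_iff_integral.2 fun φ hφ => ?_
  have hvi (i : Fin d) : ContDiff ℝ 1 fun y => v y i := contDiff_euclidean.1 hv i
  have hint_fderiv_mul (i : Fin d) : Integrable fun x =>
      fderiv ℝ (fun y => v y i) x (EuclideanSpace.single i 1) * φ x :=
    hφ.integrable_mul <| (((hvi i).continuous_fderiv one_ne_zero).clm_apply
      continuous_const).locallyIntegrable.locallyIntegrableOn _
  have hint_mul_fderiv (i : Fin d) : Integrable fun x =>
      v x i * fderiv ℝ φ x (EuclideanSpace.single i 1) :=
    ((hvi i).continuous.mul ((hφ.1.continuous_fderiv (by simp)).clm_apply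
      continuous_const)).integrable_of_hasCompactSupport ((hφ.2.1.fderiv_apply ℝ _).mul_left)
  have hinner (x : Pt d) : inner ℝ (v x) (gradient φ x) =
      ∑ i, v x i * fderiv ℝ φ x (EuclideanSpace.single i 1) := by
    simp [PiLp.inner_apply, ← inner_gradient_left]
  simp only [hinner, Finset.sum_mul]
  rw [integral_finsetSum _ fun i _ => hint_mul_fderiv i,
    integral_finsetSum _ fun i _ => hint_fderiv_mul i, ← Finset.sum_neg_distrib]
  refine Finset.sum_congr rfl fun i _ => integral_mul_fderiv_eq_neg_fderiv_mul_of_integrable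
    (hint_fderiv_mul i) (hint_mul_fderiv i) ?_ (fun x _ => (hvi i).differentiable one_ne_zero x)
    fun x _ => hφ.1.differentiable (by simp) x
  exact hφ.integrable_mul ((hvi i).continuous.locallyIntegrable.locallyIntegrableOn _)

theorem isWeakDiv_evVec (Ω : Set (Pt d)) (v : VecPoly d) :
    IsWeakDiv Ω (evVec v) (ev (divPoly v)) := by
  have hv : ContDiff ℝ 1 (evVec v) := contDiff_euclidean.2 fun i => contDiff_ev (v i)
  convert isWeakDiv_of_contDiff Ω hv using 2 with x
  simp only [evVec, fderiv_ev_single]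
  simp [ev, divPoly]

theorem isWeakGrad_const (Ω : Set (Pt d)) (a : ℝ) : IsWeakGrad Ω (fun _ => a) 0 := by
  intro ψ hψ
  have hzero : ∫ x in Ω, gradient ψ x = 0 := by
    refine ext_inner_left ℝ fun w => ?_
    rw [← integral_inner hψ.integrable_gradient.integrableOn, inner_zero_right]
    simpa using isWeakDiv_of_contDiff Ω (contDiff_const (c := w)) ψ hψ
  simp [integral_smul, hzero]

theorem ZeroNormalTrace.integral_eq_zero [IsFiniteMeasure (volume.restrict Ω)]
    (h : ZeroNormalTrace Ω v) (hg : InL2 Ω g) (hdiv : IsWeakDiv Ω v g) : ∫ x in Ω, g x = 0 := by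
  simpa using h g hg hdiv (fun _ => 1) 0 (memLp_const 1) MemLp.zero' (isWeakGrad_const Ω 1)

end WeakDiv

/-! ### Measure theory of a triangulation -/

theorem addHaar_convexHull_eq_zero {E : Type*} [NormedAddCommGroup E] [NormedSpace ℝ E]
    [FiniteDimensional ℝ E] [MeasurableSpace E] [BorelSpace E] (μ : Measure E)
    [μ.IsAddHaarMeasure] {s : Finset E} (hs : s.card ≤ Module.finrank ℝ E) :
    μ (convexHull ℝ (s : Set E)) = 0 := by
  rcases s.eq_empty_or_nonempty with rfl | hne
  · simp
  refine measure_mono_null (convexHull_subset_affineSpan _) (μ.addHaar_affineSubspace _ fun h => ?_)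
  have hspan : vectorSpan ℝ (s : Set E) = ⊤ :=
    (AffineSubspace.affineSpan_eq_top_iff_vectorSpan_eq_top_of_nonempty ℝ E E hne).1 h
  have hrank := finrank_vectorSpan_image_finset_le ℝ id s (Nat.sub_add_cancel hne.card_pos).symm
  rw [Finset.image_id, hspan, finrank_top] at hrank
  have := hne.card_pos
  omega

variable {Ω : Set (Pt d)} {T : Triangulation d Ω}

namespace Triangulation

theorem Element.isCompact_carrier (K : T.Element) : IsCompact K.carrier :=
  K.1.finite_toSet.isCompact_convexHull ℝ

theorem Element.measurableSet_carrier (K : T.Element) : MeasurableSet K.carrier :=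
  K.isCompact_carrier.measurableSet

theorem Element.interior_carrier_nonempty (K : T.Element) : (interior K.carrier).Nonempty := by
  have hspan := (T.complex.indep K.2.1).affineSpan_eq_top_iff_card_eq_finrank_add_one
  rw [Subtype.range_coe] at hspan
  exact interior_convexHull_nonempty_iff_affineSpan_eq_top.2 (hspan.2 (by simpa using K.2.2))

theorem Element.interior_carrier_ae_eq (K : T.Element) :
    interior K.carrier =ᵐ[volume] K.carrier :=
  interior_ae_eq_of_null_frontier ((convex_convexHull ℝ _).addHaar_frontier volume)

theorem Element.volume_carrier_inter_eq_zero {K K' : T.Element} (hne : K ≠ K') :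
    volume (K.carrier ∩ K'.carrier) = 0 := by
  have hcard : (K.1 ∩ K'.1).card < K.1.card := by
    refine Finset.card_lt_card (Finset.inter_subset_left.ssubset_of_ne fun h => hne ?_)
    exact Subtype.ext <| Finset.eq_of_subset_of_card_le (Finset.inter_eq_left.1 h)
      (K'.2.2.trans K.2.2.symm).le
  refine measure_mono_null (T.complex.inter_subset_convexHull K.2.1 K'.2.1) ?_
  rw [← Finset.coe_inter]
  refine addHaar_convexHull_eq_zero volume ?_
  rw [finrank_euclideanSpace_fin]
  exact Nat.le_of_lt_succ (hcard.trans_eq K.2.2)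

theorem Element.ae_choose_eq (K : T.Element) : ∀ᵐ x ∂volume.restrict K.carrier,
    ∀ h : ∃ K' : T.Element, x ∈ K'.carrier, h.choose = K := by
  have hdisj : ∀ᵐ x, ∀ K' : T.Element, K ≠ K' → x ∉ K.carrier ∩ K'.carrier :=
    ae_all_iff.2 fun K' => Filter.eventually_imp_distrib_left.2 fun hne =>
      measure_eq_zero_iff_ae_notMem.1 (volume_carrier_inter_eq_zero hne)
  filter_upwards [ae_restrict_of_ae hdisj, ae_restrict_mem K.measurableSet_carrier] with x hx hK h
  by_contra hne
  exact hx _ (Ne.symm hne) ⟨hK, h.choose_spec⟩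

theorem closure_eq_iUnion_carrier (T : Triangulation d Ω) :
    closure Ω = ⋃ K : T.Element, K.carrier := by
  rw [← T.space_eq]
  ext x
  rw [Geometry.SimplicialComplex.mem_space_iff, Set.mem_iUnion]
  constructor
  · rintro ⟨s, hs, hx⟩
    obtain ⟨t, ht, hst, hcard⟩ := T.pure s hs
    exact ⟨⟨t, ht, hcard⟩, convexHull_mono (Finset.coe_subset.2 hst) hx⟩
  · rintro ⟨K, hx⟩
    exact ⟨K.1, K.2.1, hx⟩

theorem Element.interior_carrier_subset (K : T.Element) : interior K.carrier ⊆ Ω := by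
  refine (interior_mono ?_).trans_eq T.interior_eq
  rw [closure_eq_iUnion_carrier T]
  exact Set.subset_iUnion _ K

theorem restrict_eq_restrict_iUnion_carrier (T : Triangulation d Ω) :
    volume.restrict Ω = volume.restrict (⋃ K : T.Element, K.carrier) := by
  refine Measure.restrict_congr_set (Filter.EventuallyLE.antisymm ?_ ?_)
  · exact (subset_closure.trans_eq T.closure_eq_iUnion_carrier).eventuallyLE
  · exact (Filter.EventuallyEq.countable_iUnion fun K => K.interior_carrier_ae_eq).symm.le.trans
      (Set.iUnion_subset fun K => K.interior_carrier_subset).eventuallyLE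

theorem ae_restrict_iff_forall_element (T : Triangulation d Ω) {P : Pt d → Prop} :
    (∀ᵐ x ∂volume.restrict Ω, P x) ↔
      ∀ K : T.Element, ∀ᵐ x ∂volume.restrict K.carrier, P x := by
  rw [T.restrict_eq_restrict_iUnion_carrier, ae_restrict_iUnion_iff]

theorem isFiniteMeasure_volume_restrict (T : Triangulation d Ω) :
    IsFiniteMeasure (volume.restrict Ω) := by
  rw [T.restrict_eq_restrict_iUnion_carrier, isFiniteMeasure_restrict]
  exact (isCompact_iUnion Element.isCompact_carrier).measure_ne_top

end Triangulation

/-! ### Piecewise polynomials as functions -/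

theorem Scal.toFun_ae_eq (q : Scal T) (K : T.Element) :
    q.toFun =ᵐ[volume.restrict K.carrier] ev (q K) := by
  filter_upwards [K.ae_choose_eq, ae_restrict_mem K.measurableSet_carrier] with x hx hK
  rw [Scal.toFun, dif_pos ⟨K, hK⟩, hx]

theorem Vect.toFun_ae_eq (v : Vect T) (K : T.Element) :
    v.toFun =ᵐ[volume.restrict K.carrier] evVec (v K) := by
  filter_upwards [K.ae_choose_eq, ae_restrict_mem K.measurableSet_carrier] with x hx hK
  rw [Vect.toFun, dif_pos ⟨K, hK⟩, hx]

theorem Scal.toFun_zero (x : Pt d) : (0 : Scal T).toFun x = 0 := by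
  unfold Scal.toFun
  split_ifs <;> simp [ev]

theorem Scal.toFun_add (q r : Scal T) (x : Pt d) : (q + r).toFun x = q.toFun x + r.toFun x := by
  unfold Scal.toFun
  split_ifs <;> simp [ev]

theorem Scal.toFun_smul (a : ℝ) (q : Scal T) (x : Pt d) : (a • q).toFun x = a * q.toFun x := by
  unfold Scal.toFun
  split_ifs <;> simp [ev]

theorem Scal.inL2_toFun (q : Scal T) : InL2 Ω q.toFun := by
  have : IsFiniteMeasure (volume.restrict Ω) := T.isFiniteMeasure_volume_restrict
  choose C hC using fun K : T.Element =>
    K.isCompact_carrier.exists_bound_of_continuousOn (continuous_ev (q K)).continuousOn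
  obtain ⟨M, hM⟩ := Finite.exists_le C
  refine MemLp.of_bound ?_ M (T.ae_restrict_iff_forall_element.2 fun K => ?_)
  · rw [T.restrict_eq_restrict_iUnion_carrier]
    exact .iUnion fun K => (continuous_ev _).aestronglyMeasurable.congr (q.toFun_ae_eq K).symm
  · filter_upwards [q.toFun_ae_eq K, ae_restrict_mem K.measurableSet_carrier] with x hx hK
    exact hx ▸ (hC K x hK).trans (hM K)

theorem Scal.integrable_toFun (q : Scal T) : Integrable q.toFun (volume.restrict Ω) :=
  have : IsFiniteMeasure (volume.restrict Ω) := T.isFiniteMeasure_volume_restrict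
  MemLp.integrable one_le_two q.inL2_toFun

theorem Scal.eq_zero_of_toFun_ae_eq_zero {q : Scal T} (h : q.toFun =ᵐ[volume.restrict Ω] 0) :
    q = 0 := by
  funext K
  refine eq_of_eqOn_ev isOpen_interior K.interior_carrier_nonempty ?_
  refine Measure.eqOn_open_of_ae_eq (μ := volume) ?_ isOpen_interior (continuous_ev _).continuousOn
    (continuous_ev _).continuousOn
  rw [Measure.restrict_congr_set K.interior_carrier_ae_eq]
  filter_upwards [q.toFun_ae_eq K, T.ae_restrict_iff_forall_element.1 h K] with x hx hx0
  rw [← hx, hx0]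
  simp [ev]

theorem Vect.ae_eq_div_of_isWeakDiv {v : Vect T} {g : Pt d → ℝ} (hg : LocallyIntegrableOn g Ω)
    (h : IsWeakDiv Ω v.toFun g) : g =ᵐ[volume.restrict Ω] v.div.toFun := by
  refine T.ae_restrict_iff_forall_element.2 fun K => ?_
  have hv : v.toFun =ᵐ[volume.restrict (interior K.carrier)] evVec (v K) :=
    ae_restrict_of_ae_restrict_of_subset interior_subset (v.toFun_ae_eq K)
  have hdiv : g =ᵐ[volume.restrict (interior K.carrier)] ev (divPoly (v K)) :=
    ((h.mono K.interior_carrier_subset).congr_ae hv).ae_eq isOpen_interior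
      (hg.mono_set K.interior_carrier_subset)
      ((continuous_ev _).locallyIntegrable.locallyIntegrableOn _) (isWeakDiv_evVec _ _)
  rw [Measure.restrict_congr_set K.interior_carrier_ae_eq] at hdiv
  exact hdiv.trans (v.div.toFun_ae_eq K).symm

theorem Vect.integral_div_eq_zero {v : Vect T} (hv : InHDiv Ω v.toFun)
    (hn : ZeroNormalTrace Ω v.toFun) : ∫ x in Ω, v.div.toFun x = 0 := by
  have : IsFiniteMeasure (volume.restrict Ω) := T.isFiniteMeasure_volume_restrict
  obtain ⟨-, g, hg, hdiv⟩ := hv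
  have hgi : IntegrableOn g Ω := MemLp.integrable one_le_two hg
  rw [← integral_congr_ae (Vect.ae_eq_div_of_isWeakDiv hgi.locallyIntegrableOn hdiv)]
  exact hn.integral_eq_zero hg hdiv

/-! ### The pressure space and its projection -/

/-- The pressure space `P_h` as a linear subspace of the piecewise polynomials. -/
def PhSubmodule (T : Triangulation d Ω) (l : ℕ) : Submodule ℝ (Scal T) where
  carrier := Ph T l
  zero_mem' := ⟨fun _ => zero_mem _, Scal.inL2_toFun 0, by simp [Scal.toFun_zero]⟩
  add_mem' {q r} hq hr := by
    refine ⟨fun K => add_mem (hq.1 K) (hr.1 K), (q + r).inL2_toFun, ?_⟩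
    simp only [Scal.toFun_add]
    rw [integral_add q.integrable_toFun r.integrable_toFun, hq.2.2, hr.2.2, add_zero]
  smul_mem' a q hq := by
    refine ⟨fun K => Submodule.smul_mem _ a (hq.1 K), (a • q).inL2_toFun, ?_⟩
    simp only [Scal.toFun_smul, integral_const_mul, hq.2.2, mul_zero]

theorem div_mem_Ph_of_mem_Uh {fam : Family} {l : ℕ} (hl : 1 ≤ l) {u : Vect T}
    (hu : u ∈ Uh T fam l) : u.div ∈ Ph T l := by
  refine ⟨fun K => ?_, u.div.inL2_toFun, Vect.integral_div_eq_zero hu.2.1 hu.2.2⟩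
  obtain ⟨k, rfl⟩ := Nat.exists_eq_add_of_le' hl
  have hK := hu.1 K
  cases fam with
  | BDM => exact divPoly_mem_Pk hK
  | BDFM => exact divPoly_mem_Pk hK.1

theorem div_mem_Ph_of_mem_Vh {l : ℕ} {v : Vect T} (hv : v ∈ Vh T l) : v.div ∈ Ph T l :=
  ⟨fun K => divPoly_mem_Pk_of_mem_localRT (hv.1 K), v.div.inL2_toFun,
    Vect.integral_div_eq_zero hv.2.1 hv.2.2⟩

theorem integrable_mul_toFun {g : Pt d → ℝ} (hg : InL2 Ω g) (q : Scal T) :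
    Integrable (fun x => g x * q.toFun x) (volume.restrict Ω) :=
  MemLp.integrable_mul hg q.inL2_toFun

/-- The `L²(Ω)` inner product of piecewise polynomials. -/
noncomputable def l2Form (T : Triangulation d Ω) : LinearMap.BilinForm ℝ (Scal T) :=
  LinearMap.mk₂ ℝ (fun q r => ∫ x in Ω, q.toFun x * r.toFun x)
    (fun q q' r => by
      simp only [Scal.toFun_add, add_mul]
      exact integral_add (integrable_mul_toFun q.inL2_toFun r)
        (integrable_mul_toFun q'.inL2_toFun r))
    (fun a q r => by simp only [Scal.toFun_smul, mul_assoc, integral_const_mul, smul_eq_mul])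
    (fun q r r' => by
      simp only [Scal.toFun_add, mul_add]
      exact integral_add (integrable_mul_toFun q.inL2_toFun r)
        (integrable_mul_toFun q.inL2_toFun r'))
    (fun a q r => by
      simp only [Scal.toFun_smul, mul_left_comm, integral_const_mul, smul_eq_mul])

theorem l2Form_apply (q r : Scal T) : l2Form T q r = ∫ x in Ω, q.toFun x * r.toFun x := rfl

theorem eq_zero_of_l2Form_self_eq_zero {q : Scal T} (h : l2Form T q q = 0) : q = 0 := by
  have hsq := (integral_eq_zero_iff_of_nonneg (fun x => mul_self_nonneg (q.toFun x))
    (integrable_mul_toFun q.inL2_toFun q)).1 h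
  exact Scal.eq_zero_of_toFun_ae_eq_zero (hsq.mono fun x hx => mul_self_eq_zero.1 hx)

theorem isL2Projection_iff {l : ℕ} {g : Pt d → ℝ} (hg : InL2 Ω g) {q : Scal T} :
    IsL2Projection l g q ↔
      q ∈ Ph T l ∧ ∀ r ∈ Ph T l, l2Form T q r = ∫ x in Ω, g x * r.toFun x := by
  refine and_congr_right fun _ => forall₂_congr fun r _ => ?_
  simp only [sub_mul]
  rw [integral_sub (integrable_mul_toFun hg r) (integrable_mul_toFun q.inL2_toFun r),
    ← l2Form_apply, sub_eq_zero, eq_comm]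

theorem IsL2Projection.unique {l : ℕ} {g : Pt d → ℝ} (hg : InL2 Ω g) {q r : Scal T}
    (hq : IsL2Projection l g q) (hr : IsL2Projection l g r) : q = r := by
  have hmem : q - r ∈ Ph T l := (PhSubmodule T l).sub_mem hq.1 hr.1
  refine sub_eq_zero.1 (eq_zero_of_l2Form_self_eq_zero ?_)
  rw [LinearMap.map_sub₂, ((isL2Projection_iff hg).1 hq).2 _ hmem,
    ((isL2Projection_iff hg).1 hr).2 _ hmem, sub_self]

theorem isL2Projection_zero {l : ℕ} {g : Pt d → ℝ} (hg : g =ᵐ[volume.restrict Ω] 0) :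
    IsL2Projection l g (0 : Scal T) :=
  ⟨(PhSubmodule T l).zero_mem, fun r _ => integral_eq_zero_of_ae <|
    hg.mono fun x hx => by simp [hx, Scal.toFun_zero]⟩

/-! ### The discrete mass balance -/

section MassBalance

variable {n l : ℕ} {fam : Family}

/-- The left-hand side of the `i`-th mass-balance equation as a piecewise polynomial. -/
noncomputable def massBalancePoly (c : Params n) (u : Vect T) (v : Fin n → Vect T)
    (p : Fin n → Scal T) (i : Fin n) : Scal T :=
  -u.div - (v i).div - (c.αp i + c.α i i) • p i + ∑ j ∈ Finset.univ.erase i, c.α i j • p j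

variable (c : Params n) {u : Vect T} {v : Fin n → Vect T} {p : Fin n → Scal T} {i : Fin n}

theorem ev_massBalancePoly (K : T.Element) (x : Pt d) :
    ev (massBalancePoly c u v p i K) x = massBalance c u v p i K x := by
  simp [ev, massBalancePoly, massBalance, Vect.div]

theorem massBalancePoly_mem_Ph (hl : 1 ≤ l) (hu : u ∈ Uh T fam l) (hv : v i ∈ Vh T l)
    (hp : ∀ j, p j ∈ Ph T l) : massBalancePoly c u v p i ∈ Ph T l :=
  show _ ∈ PhSubmodule T l from
  have hp' (j : Fin n) : p j ∈ PhSubmodule T l := hp j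
  add_mem (sub_mem (sub_mem (neg_mem (div_mem_Ph_of_mem_Uh hl hu)) (div_mem_Ph_of_mem_Vh hv))
    (Submodule.smul_mem _ _ (hp' i))) (sum_mem fun j _ => Submodule.smul_mem _ _ (hp' j))

theorem l2Form_massBalancePoly (q : Scal T) : l2Form T (massBalancePoly c u v p i) q =
    -l2Form T u.div q - l2Form T (v i).div q + (-c.αp i - c.α i i) * l2Form T (p i) q
      + ∑ j ∈ Finset.univ.erase i, c.α i j * l2Form T (p j) q := by
  simp only [massBalancePoly, LinearMap.map_add₂, LinearMap.map_sub₂, LinearMap.map_neg₂,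
    LinearMap.map_smul₂, LinearMap.map_sum₂, smul_eq_mul]
  ring

theorem isL2Projection_massBalancePoly (hl : 1 ≤ l) {g : Pt d → ℝ} (hg : InL2 Ω g)
    (hu : u ∈ Uh T fam l) (hv : v i ∈ Vh T l) (hp : ∀ j, p j ∈ Ph T l)
    (hmass : ∀ q ∈ Ph T l,
      -l2Form T u.div q - l2Form T (v i).div q + (-c.αp i - c.α i i) * l2Form T (p i) q
        + ∑ j ∈ Finset.univ.erase i, c.α i j * l2Form T (p j) q = ∫ x in Ω, g x * q.toFun x) :
    IsL2Projection l g (massBalancePoly c u v p i) :=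
  (isL2Projection_iff hg).2 ⟨massBalancePoly_mem_Ph c hl hu hv hp, fun q hq =>
    (l2Form_massBalancePoly c q).trans (hmass q hq)⟩

end MassBalance

end MPET

open MPET MeasureTheory in
theorem proposition4p1_general {d n l : ℕ} (hl : 1 ≤ l) {Ω : Set (Pt d)} {T : Triangulation d Ω}
    {fam : Family} (c : Params n) {g : Pt d → ℝ} (hg : InL2 Ω g)
    {u : Vect T} {v : Fin n → Vect T} {p : Fin n → Scal T} {i : Fin n}
    (hu : u ∈ Uh T fam l) (hv : v i ∈ Vh T l) (hp : ∀ j, p j ∈ Ph T l)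
    (hmass : ∀ q ∈ Ph T l,
      -(∫ x in Ω, u.div.toFun x * q.toFun x) - (∫ x in Ω, (v i).div.toFun x * q.toFun x)
        + (-c.αp i - c.α i i) * (∫ x in Ω, (p i).toFun x * q.toFun x)
        + ∑ j ∈ Finset.univ.erase i, c.α i j * (∫ x in Ω, (p j).toFun x * q.toFun x)
        = ∫ x in Ω, g x * q.toFun x) :
    (∃! q : Scal T, IsL2Projection l g q) ∧
    (∀ q : Scal T, IsL2Projection l g q →
      ∀ (K : T.Element) (x : Pt d), massBalance c u v p i K x = ev (q K) x) ∧
    (g =ᵐ[volume.restrict Ω] 0 →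
      ∀ (K : T.Element) (x : Pt d), massBalance c u v p i K x = 0) := by
  have hproj := isL2Projection_massBalancePoly c hl hg hu hv hp hmass
  have heq (q : Scal T) (hq : IsL2Projection l g q) (K : T.Element) (x : Pt d) :
      massBalance c u v p i K x = ev (q K) x := by
    rw [hq.unique hg hproj, ev_massBalancePoly]
  refine ⟨⟨_, hproj, fun q hq => hq.unique hg hproj⟩, heq, fun hg0 K x => ?_⟩
  rw [heq 0 (isL2Projection_zero hg0)]
  simp [ev]

open MPET MeasureTheory in
theorem proposition4p1 (d n l : ℕ) (hd : d = 2 ∨ d = 3) (hl : 1 ≤ l)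
    (Ω : Set (Pt d)) (hΩ : IsOpen Ω) (T : Triangulation d Ω)
    (fam : Family) (η : ℝ) (c : Params n)
    (f : Pt d → Pt d) (hf : InL2 Ω f) (g : Fin n → Pt d → ℝ) (hg : ∀ i, InL2 Ω (g i))
    (u : Vect T) (v : Fin n → Vect T) (p : Fin n → Scal T)
    (hsol : IsDiscreteSolution fam l η c f g u v p) (i : Fin n) :
    (∃! q : Scal T, IsL2Projection l (g i) q) ∧
    (∀ q : Scal T, IsL2Projection l (g i) q →
      ∀ K : T.Element, ∀ x ∈ K.carrier, massBalance c u v p i K x = ev (q K) x) ∧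
    (g i =ᵐ[volume.restrict Ω] 0 →
      ∀ K : T.Element, ∀ x ∈ K.carrier, massBalance c u v p i K x = 0) := by
  have h := proposition4p1_general hl c (hg i) hsol.u_mem (hsol.v_mem i) hsol.p_mem (hsol.mass i)
  exact ⟨h.1, fun q hq K x _ => h.2.1 q hq K x, fun hg0 K x _ => h.2.2 hg0 K x⟩
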